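/- A composition is a nonempty finite list $\alpha=(a_1,\dots,a_k)$ of positive integers, of length $l(\alpha)=k$ and size $|\alpha|=a_1+\dots+a_k$. Its reversal is $\alpha^*=(a_k,\dots,a_1)$; $\alpha$ is symmetric if $\alpha=\alpha^*$, asymmetric otherwise, and lexicographic minimal if $\alpha\le\alpha^*$ in the lexicographic order. For compositions $\alpha=(a_1,\dots,a_k)$ and $\beta=(b_1,\dots,b_\ell)$ let $\alpha\cdot\beta$ denote concatenation, let $\alpha\odot\beta=(a_1,\dots,a_{k-1},a_k+b_1,b_2,\dots,b_\ell)$, let $\beta^{\odot n}=\beta\odot\dots\odot\beta$ ($n\geq1$ factors), and let $\alpha\circ\beta=\beta^{\odot a_1}\cdot\beta^{\odot a_2}\cdots\beta^{\odot a_k}$. A factorisation $\beta\circ\gamma$ is trivial if one of $\beta,\gamma$ is $(1)$, or both have length $1$, or both have all components equal to $1$. A composition is irreducible if its length is not $1$, not all its components are $1$, and all its factorisations $\beta\circ\gamma$ are trivial. An irreducible factorisation of $\alpha$ is an expression $\alpha=\alpha_1\circ\dots\circ\alpha_k$ with $k\ge1$ such that no $\alpha_i\circ\alpha_{i+1}$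 is a trivial factorisation and each $\alpha_i$ admits only trivial factorisations. A composition is normalised if all factors of its (unique) irreducible factorisation are lexicographic minimal. The Dirichlet generating function of a set $A$ of compositions is the formal Dirichlet series $A(s)=\sum_{\alpha\in A}|\alpha|^{-s}$ with integer coefficients; products and inverses of formal Dirichlet series are taken with respect to Dirichlet convolution. Let $P(s)$, $P^*(s)$, $P^\times(s)$, $R(s)$ and $S(s)$ be the Dirichlet generating functions of, respectively, the normalised irreducible compositions, the symmetric irreducible compositions, the normalised asymmetric irreducible compositions, the normalised compositions and the symmetric compositions, and let $\zeta(s)=\sum_{n\ge1}n^{-s}$. Then $S(s)=\sum_{n\ge1}2^{\lfloor n/2\rfloor}n^{-s}$, the series $\zeta(s)$, $R(s)$ and $S(s)$ are invertible, and $$P(s)=2\zeta^{-1}(s)-1-R^{-1}(s),\qquad P^*(s)=2\zeta^{-1}(s)-1-S^{-1}(s),\qquad P^\times(s)=S^{-1}(s)-R^{-1}(s).$$ -/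

import Mathlib

/-- A composition `(a₁, …, a_k)` of a positive integer: a nonempty list of positive integers. -/
@[ext]
structure Compn where
  /-- The components `a₁, …, a_k`. -/
  parts : List ℕ
  ne_nil : parts ≠ []
  pos : ∀ a ∈ parts, 0 < a

namespace Compn

/-- The size `|α| = a₁ + ⋯ + a_k`. -/
def size (α : Compn) : ℕ := α.parts.sum

/-- The length `l(α) = k`. -/
def length (α : Compn) : ℕ := α.parts.length

/-- The composition `(1)`. -/
def one : Compn where
  parts := [1]
  ne_nil := by simp
  pos := by simp

/-- Near concatenation `α ⊙ β = (a₁, …, a_k + b₁, …, b_l)`. -/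
def nearConcat (α β : Compn) : Compn where
  parts := α.parts.dropLast ++
    (α.parts.getLast α.ne_nil + β.parts.head β.ne_nil) :: β.parts.tail
  ne_nil := by simp
  pos := by
    intro a ha
    rcases List.mem_append.1 ha with h | h
    · exact α.pos a (List.mem_of_mem_dropLast h)
    · rcases List.mem_cons.1 h with h | h
      · have := α.pos _ (List.getLast_mem α.ne_nil)
        omega
      · exact β.pos a (List.mem_of_mem_tail h)

/-- `β.nearPow n = β ⊙ ⋯ ⊙ β` with `n` factors `β`. It is only used for `n ≥ 1`. -/
def nearPow (β : Compn) (n : ℕ) : Compn := (fun γ => nearConcat γ β)^[n - 1] β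

/-- The composition of compositions: for `α = (a₁, …, a_k)`, the composition `α ∘ β` is the
concatenation of the near powers `β^{⊙ a₁}, …, β^{⊙ a_k}`. -/
def comp (α β : Compn) : Compn where
  parts := α.parts.flatMap fun a => (β.nearPow a).parts
  ne_nil := by
    intro h
    rw [List.flatMap_eq_nil_iff] at h
    obtain ⟨a, ha⟩ := List.exists_mem_of_ne_nil _ α.ne_nil
    exact (β.nearPow a).ne_nil (h a ha)
  pos := by
    intro b hb
    obtain ⟨a, _, hb⟩ := List.mem_flatMap.1 hb
    exact (β.nearPow a).pos b hb

/-- The reversal `α* = (a_k, …, a₁)`. -/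
def reversal (α : Compn) : Compn where
  parts := α.parts.reverse
  ne_nil := by simpa using α.ne_nil
  pos := fun a ha => α.pos a (List.mem_reverse.1 ha)

/-- `α` is symmetric if it coincides with its reversal. -/
def IsSymmetric (α : Compn) : Prop := α = α.reversal

/-- All components of `α` are equal to `1`. -/
def AllOnes (α : Compn) : Prop := ∀ a ∈ α.parts, a = 1

/-- The factorisation `β ∘ γ` is trivial. -/
def IsTrivialPair (β γ : Compn) : Prop :=
  (β = one ∨ γ = one) ∨ (β.length = 1 ∧ γ.length = 1) ∨ (β.AllOnes ∧ γ.AllOnes)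

/-- Every factorisation `α = β ∘ γ` is trivial. -/
def OnlyTrivialFactorisations (α : Compn) : Prop :=
  ∀ β γ : Compn, α = comp β γ → IsTrivialPair β γ

/-- The irreducible compositions. -/
def IsIrreducible (α : Compn) : Prop :=
  α.length ≠ 1 ∧ ¬ α.AllOnes ∧ α.OnlyTrivialFactorisations

/-- The list `[α₁, …, α_k]`, with `k ≥ 1`, is an irreducible factorisation of `α`, that is
`α = α₁ ∘ ⋯ ∘ α_k`, no `α_i ∘ α_{i+1}` is a trivial factorisation, and each `α_i` admits only
trivial factorisations. -/
def IsIrreducibleFactorisation (fs : List Compn) (α : Compn) : Prop :=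
  fs ≠ [] ∧ α = fs.foldr comp one ∧
    fs.IsChain (fun β γ => ¬ IsTrivialPair β γ) ∧
    ∀ β ∈ fs, β.OnlyTrivialFactorisations

/-- `α ≤ α*` in the lexicographic order (note that `α` and `α*` have the same length). -/
def IsLexMinimal (α : Compn) : Prop := α.parts ≤ α.reversal.parts

/-- `α` is normalised if all factors in its irreducible factorisation are lexicographic minimal. -/
def IsNormalised (α : Compn) : Prop :=
  ∃ fs : List Compn, IsIrreducibleFactorisation fs α ∧ ∀ β ∈ fs, β.IsLexMinimal

theorem one_le_size (α : Compn) : 1 ≤ α.size := by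
  obtain ⟨a, ha⟩ := List.exists_mem_of_ne_nil _ α.ne_nil
  exact (α.pos a ha).trans_le (List.le_sum_of_mem ha)

/-- There are only finitely many compositions of size `n`, so the cardinality in `dgf` below is
a genuine one. -/
theorem finite_size_eq (n : ℕ) : {α : Compn | α.size = n}.Finite := by
  let f : {α : Compn | α.size = n} → Composition n := fun α =>
    { blocks := α.1.parts
      blocks_pos := fun {i} hi => α.1.pos i hi
      blocks_sum := α.2 }
  have hf : Function.Injective f := by
    intro α β h
    exact Subtype.ext (Compn.ext (congrArg Composition.blocks h))
  exact Set.finite_coe_iff.1 (Finite.of_injective f hf)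

/-- The formal Dirichlet generating function `A(s) = ∑_{α ∈ A} |α|^{-s}` of a set `A` of
compositions. A formal Dirichlet series `∑_{n ≥ 1} a_n n^{-s}` is represented by the arithmetic
function `n ↦ a_n`; multiplication is Dirichlet convolution. -/
noncomputable def dgf (A : Set Compn) : ArithmeticFunction ℤ where
  toFun n := ({α : Compn | α ∈ A ∧ α.size = n}.ncard : ℤ)
  map_zero' := by
    have : {α : Compn | α ∈ A ∧ α.size = 0} = ∅ := by
      ext α
      have := α.one_le_size
      simp only [Set.mem_ofPred_eq, Set.mem_empty_iff_false, iff_false]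
      omega
    simp [this]

end Compn

/-!
A composition `α` of size `n` is encoded by its set of cuts, the `n`-periodic set of integers
generated by the partial sums of `α`. The cuts of `α ∘ β` are `|β|` times the cuts of `α` at the
multiples of `|β|`, and the cuts of `β` elsewhere. Hence `α` has a right factor of size `m ∣ n` if
and only if its cuts are `m`-periodic away from the multiples of `m`, and the sizes of its right
factors are closed under gcd and lcm. This makes irreducible left factors unique, and so is, for
each of the two kinds of compositions without internal structure (length `1`, or all components
equal to `1`), the largest left factor of that kind; moreover nontrivial left factors of both kinds
do not occur together.

Let `X(s)` count the symmetric, or the normalised, compositions, and `P(s)` the irreducible ones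
among them. As there is exactly one composition of either kind in each size, the elements of `X`
without a nontrivial left factor of a given kind are counted by `ζ⁻¹(s) X(s)`. Every element of `X`
is of this sort for at least one of the two kinds, and those for which it is for both are `(1)` and
the `π ∘ β` with `π` irreducible. Inclusion–exclusion gives
`2 ζ⁻¹(s) X(s) = X(s) + 1 + P(s) X(s)`, which is then solved for `P(s)`.
-/

section PartialSums

theorem mem_partialSums_iff_exists_append {M : Type*} [AddMonoid M] {l : List M} {x : M} :
    x ∈ l.partialSums ↔ ∃ s t, l = s ++ t ∧ s.sum = x := by
  induction l generalizing x with
  | nil => simp [eq_comm]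
  | cons a l ih =>
    simp only [List.partialSums_cons, List.mem_cons, List.mem_map, ih, List.cons_eq_append_iff]
    constructor
    · rintro (rfl | ⟨_, ⟨s, t, rfl, rfl⟩, rfl⟩)
      · exact ⟨[], a :: l, by simp⟩
      · exact ⟨a :: s, t, by simp⟩
    · rintro ⟨_, t, ⟨rfl, -⟩ | ⟨s, rfl, rfl⟩, rfl⟩
      · exact Or.inl rfl
      · exact Or.inr ⟨_, ⟨s, t, rfl, rfl⟩, List.sum_cons.symm⟩

theorem zero_mem_partialSums {M : Type*} [AddMonoid M] (l : List M) : 0 ∈ l.partialSums :=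
  mem_partialSums_iff_exists_append.2 ⟨[], l, rfl, rfl⟩

theorem sum_mem_partialSums {M : Type*} [AddMonoid M] (l : List M) : l.sum ∈ l.partialSums :=
  mem_partialSums_iff_exists_append.2 ⟨l, [], by simp, rfl⟩

theorem mem_partialSums_cons {M : Type*} [AddMonoid M] {a : M} {l : List M} {x : M} :
    x ∈ (a :: l).partialSums ↔ x = 0 ∨ ∃ y ∈ l.partialSums, a + y = x := by
  simp [List.partialSums_cons]

theorem mem_partialSums_append {M : Type*} [AddMonoid M] {l₁ l₂ : List M} {x : M} :
    x ∈ (l₁ ++ l₂).partialSums ↔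
      x ∈ l₁.partialSums ∨ ∃ y ∈ l₂.partialSums, l₁.sum + y = x := by
  induction l₁ generalizing x with
  | nil =>
    simp only [List.nil_append, List.partialSums_nil, List.mem_singleton, List.sum_nil, zero_add,
      exists_eq_right, iff_or_self]
    rintro rfl
    exact zero_mem_partialSums l₂
  | cons a l₁ ih =>
    simp only [List.cons_append, mem_partialSums_cons, ih, List.sum_cons, add_assoc]
    aesop

theorem mem_partialSums_reverse {M : Type*} [AddCancelCommMonoid M] {l : List M} {x : M} :
    x ∈ l.reverse.partialSums ↔ ∃ y ∈ l.partialSums, x + y = l.sum := by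
  simp only [mem_partialSums_iff_exists_append]
  constructor
  · rintro ⟨s, t, h, rfl⟩
    refine ⟨_, ⟨t.reverse, s.reverse, ?_, rfl⟩, ?_⟩
    · rw [← List.reverse_append, ← h, List.reverse_reverse]
    · rw [← l.sum_reverse, h, List.sum_append, List.sum_reverse]
  · rintro ⟨_, ⟨s, t, rfl, rfl⟩, h⟩
    refine ⟨t.reverse, s.reverse, by rw [List.reverse_append], ?_⟩
    rw [List.sum_append, add_comm] at h
    rw [List.sum_reverse, add_left_cancel h]

theorem le_sum_of_mem_partialSums {l : List ℕ} {i : ℕ} (h : i ∈ l.partialSums) : i ≤ l.sum := by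
  obtain ⟨s, t, rfl, rfl⟩ := mem_partialSums_iff_exists_append.1 h
  simp

theorem mem_partialSums_append_add_cons {l m : List ℕ} {a b : ℕ} (ha : 0 < a) (hb : 0 < b)
    {i : ℕ} : i ∈ (l ++ (a + b) :: m).partialSums ↔
      i ≠ l.sum + a ∧ i ∈ ((l ++ [a]) ++ b :: m).partialSums := by
  have hle : i ∈ l.partialSums → i ≤ l.sum := le_sum_of_mem_partialSums
  simp only [mem_partialSums_append, mem_partialSums_cons, List.partialSums_nil,
    List.mem_singleton, List.sum_append, List.sum_singleton, or_and_right, exists_or,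
    exists_eq_left, exists_exists_and_eq_and]
  grind

theorem mem_boundaries_iff_mem_partialSums {n : ℕ} (c : CompositionAsSet n) (j : Fin (n + 1)) :
    j ∈ c.boundaries ↔ (j : ℕ) ∈ c.blocks.partialSums := by
  rw [c.mem_boundaries_iff_exists_blocks_sum_take_eq, mem_partialSums_iff_exists_append,
    c.card_boundaries_eq_succ_length, ← c.blocks_length]
  constructor
  · rintro ⟨i, -, hi⟩
    exact ⟨_, _, (List.take_append_drop i c.blocks).symm, hi⟩
  · rintro ⟨s, t, hst, hs⟩
    exact ⟨s.length, by simp [hst], by rwa [hst, List.take_left]⟩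

theorem composition_ext_partialSums {n : ℕ} {c c' : Composition n}
    (h : ∀ i, i ∈ c.blocks.partialSums ↔ i ∈ c'.blocks.partialSums) : c = c' := by
  refine (compositionEquiv n).injective (CompositionAsSet.ext (Finset.ext fun j => ?_))
  change j ∈ c.toCompositionAsSet.boundaries ↔ j ∈ c'.toCompositionAsSet.boundaries
  simpa only [mem_boundaries_iff_mem_partialSums, Composition.toCompositionAsSet_blocks] using h j

theorem exists_composition_mem_partialSums_iff (n : ℕ) (p : ℕ → Prop) :
    ∃ c : Composition n, ∀ i, 0 < i → i < n → (i ∈ c.blocks.partialSums ↔ p i) := by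
  classical
  let s : CompositionAsSet n :=
    { boundaries := {j | j = 0 ∨ j = Fin.last n ∨ p j}
      zero_mem := by simp
      getLast_mem := by simp }
  refine ⟨s.toComposition, fun i hi hin => ?_⟩
  let j : Fin (n + 1) := ⟨i, by omega⟩
  calc i ∈ s.blocks.partialSums ↔ j ∈ s.boundaries := (mem_boundaries_iff_mem_partialSums s j).symm
    _ ↔ j = 0 ∨ j = Fin.last n ∨ p j := by simp [s]
    _ ↔ p i := by simp [j, Fin.ext_iff, hi.ne', hin.ne]

end PartialSums

section Periodicity

/-- `p` is `n`-periodic away from the multiples of `n`: whether `p i` holds depends only on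
`i mod n` when `n ∤ i`, while nothing is required of `p` at the multiples of `n`. -/
def IsPeriodicOff (n : ℕ) (p : ℤ → Prop) : Prop :=
  ∀ i j : ℤ, ¬ (n : ℤ) ∣ i → i ≡ j [ZMOD n] → (p i ↔ p j)

theorem exists_modEq_and_modEq {n m : ℕ} {i j : ℤ} (h : i ≡ j [ZMOD n.gcd m]) :
    ∃ k, i ≡ k [ZMOD n] ∧ k ≡ j [ZMOD m] := by
  obtain ⟨c, hc⟩ := h.dvd
  rw [Nat.gcd_eq_gcd_ab] at hc
  refine ⟨i + n * (n.gcdA m * c), ?_, Int.modEq_iff_dvd.2 ⟨n.gcdB m * c, ?_⟩⟩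
  · simp [Int.modEq_iff_dvd]
  · linear_combination hc

namespace IsPeriodicOff

variable {n m : ℕ} {p : ℤ → Prop}

theorem gcd (hn : IsPeriodicOff n p) (hm : IsPeriodicOff m p) : IsPeriodicOff (n.gcd m) p := by
  intro i j hi hij
  have hgn : ((n.gcd m : ℕ) : ℤ) ∣ n := mod_cast n.gcd_dvd_left m
  have hgm : ((n.gcd m : ℕ) : ℤ) ∣ m := mod_cast n.gcd_dvd_right m
  obtain ⟨k, hik, hkj⟩ := exists_modEq_and_modEq hij
  have hk : ¬ (m : ℤ) ∣ k := fun h => hi ((hik.of_dvd hgn).dvd_iff.2 (hgm.trans h))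
  exact (hn i k (fun h => hi (hgn.trans h)) hik).trans (hm k j hk hkj)

theorem lcm (hn : IsPeriodicOff n p) (hm : IsPeriodicOff m p) : IsPeriodicOff (n.lcm m) p := by
  intro i j hi hij
  by_cases hni : (n : ℤ) ∣ i
  · have hmi : ¬ (m : ℤ) ∣ i := fun hmi => hi (Int.coe_lcm_dvd hni hmi)
    exact hm i j hmi (hij.of_dvd (mod_cast n.dvd_lcm_right m))
  · exact hn i j hni (hij.of_dvd (mod_cast n.dvd_lcm_left m))

theorem iff_of_dvd_of_dvd (hn : IsPeriodicOff n p) (hm : IsPeriodicOff m p) {i j : ℤ}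
    (hni : (n : ℤ) ∣ i) (hmi : ¬ (m : ℤ) ∣ i) (hmj : (m : ℤ) ∣ j) (hnj : ¬ (n : ℤ) ∣ j) :
    p i ↔ p j := by
  have hgi : ((m.gcd n : ℕ) : ℤ) ∣ i := .trans (mod_cast m.gcd_dvd_right n) hni
  have hgj : ((m.gcd n : ℕ) : ℤ) ∣ j := .trans (mod_cast m.gcd_dvd_left n) hmj
  obtain ⟨k, hik, hkj⟩ := exists_modEq_and_modEq
    ((Int.modEq_zero_iff_dvd.2 hgi).trans (Int.modEq_zero_iff_dvd.2 hgj).symm)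
  have hk : ¬ (n : ℤ) ∣ k := fun h => hnj (hkj.dvd_iff.1 h)
  exact (hm i k hmi hik).trans (hn k j hk hkj)

end IsPeriodicOff

end Periodicity

namespace Compn

section Cuts

/-- `i` is a cut of `α`: some component of `α` starts at `i` when the line is tiled by
the components of `α`, repeated periodically in both directions from the origin. -/
def IsCut (α : Compn) (i : ℤ) : Prop := ∃ j ∈ α.parts.partialSums, i ≡ j [ZMOD α.size]

theorem isCut_congr {α : Compn} {i j : ℤ} (h : i ≡ j [ZMOD α.size]) : α.IsCut i ↔ α.IsCut j :=
  exists_congr fun _ => and_congr_right fun _ => ⟨h.symm.trans, h.trans⟩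

theorem isCut_of_dvd {α : Compn} {i : ℤ} (h : (α.size : ℤ) ∣ i) : α.IsCut i :=
  ⟨0, zero_mem_partialSums _, Int.modEq_zero_iff_dvd.2 h⟩

theorem mem_partialSums_parts_iff {α : Compn} {i : ℕ} :
    i ∈ α.parts.partialSums ↔ i ≤ α.size ∧ α.IsCut i := by
  refine ⟨fun h => ⟨le_sum_of_mem_partialSums h, i, h, rfl⟩, ?_⟩
  rintro ⟨hi, j, hj, hij⟩
  have hij : i ≡ j [MOD α.size] := Int.natCast_modEq_iff.1 hij
  have hj' : j ≤ α.size := le_sum_of_mem_partialSums hj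
  rcases hi.eq_or_lt with rfl | hi
  · exact sum_mem_partialSums _
  rcases hj'.eq_or_lt with rfl | hj'
  · rw [Nat.eq_zero_of_dvd_of_lt (hij.dvd_iff dvd_rfl |>.2 dvd_rfl) hi]
    exact zero_mem_partialSums _
  · rwa [hij.eq_of_lt_of_lt hi hj']

theorem exists_natCast_modEq (α : Compn) (i : ℤ) :
    ∃ j : ℕ, j < α.size ∧ i ≡ j [ZMOD α.size] := by
  obtain ⟨j, hj, hji⟩ := Int.existsUnique_equiv_nat i (Int.natCast_pos.2 α.one_le_size)
  exact ⟨j, Int.ofNat_lt.1 hj, hji.symm⟩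

theorem ext_isCut {α β : Compn} (hs : α.size = β.size)
    (h : ∀ i : ℤ, ¬ (α.size : ℤ) ∣ i → (α.IsCut i ↔ β.IsCut i)) : α = β := by
  let c : Composition α.size := ⟨α.parts, fun {i} => α.pos i, rfl⟩
  let c' : Composition α.size := ⟨β.parts, fun {i} => β.pos i, hs.symm⟩
  suffices hc : c = c' from Compn.ext (congrArg Composition.blocks hc)
  refine composition_ext_partialSums fun i => ?_
  change i ∈ α.parts.partialSums ↔ i ∈ β.parts.partialSums
  rw [mem_partialSums_parts_iff, mem_partialSums_parts_iff, hs]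
  by_cases hi : (α.size : ℤ) ∣ i
  · simp only [isCut_of_dvd hi, isCut_of_dvd (hs ▸ hi)]
  · rw [h i hi]

theorem exists_isCut_iff {n : ℕ} (hn : 0 < n) {p : ℤ → Prop} (hp : IsPeriodicOff n p) :
    ∃ α : Compn, α.size = n ∧ ∀ i : ℤ, ¬ (n : ℤ) ∣ i → (α.IsCut i ↔ p i) := by
  obtain ⟨c, hc⟩ := exists_composition_mem_partialSums_iff n fun i => p i
  have hne : c.blocks ≠ [] := fun h => hn.ne (by simpa [h] using c.blocks_sum)
  let α : Compn := ⟨c.blocks, hne, fun _ => c.blocks_pos⟩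
  have hα : α.size = n := c.blocks_sum
  refine ⟨α, hα, fun i hi => ?_⟩
  obtain ⟨j, hj, hij⟩ := α.exists_natCast_modEq i
  rw [hα] at hj hij
  have hj0 : 0 < j := by
    rw [Nat.pos_iff_ne_zero]
    rintro rfl
    exact hi (Int.modEq_zero_iff_dvd.1 hij)
  calc α.IsCut i ↔ α.IsCut j := isCut_congr (hα ▸ hij)
    _ ↔ j ∈ c.blocks.partialSums := by
      rw [show c.blocks = α.parts from rfl, mem_partialSums_parts_iff, and_iff_right (by omega)]
    _ ↔ p j := hc j hj0 hj
    _ ↔ p i := (hp i j hi hij).symm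

theorem size_reversal (α : Compn) : α.reversal.size = α.size :=
  α.parts.sum_reverse

theorem isCut_reversal {α : Compn} {i : ℤ} : α.reversal.IsCut i ↔ α.IsCut (-i) := by
  rw [IsCut, size_reversal]
  simp only [reversal, mem_partialSums_reverse]
  constructor
  · rintro ⟨j, ⟨k, hk, hjk⟩, hij⟩
    refine ⟨k, hk, hij.neg.trans (Int.modEq_iff_dvd.2 ⟨1, ?_⟩)⟩
    rw [size, ← hjk]
    push_cast
    ring
  · rintro ⟨k, hk, hik⟩
    obtain ⟨j, hj⟩ := Nat.exists_eq_add_of_le (le_sum_of_mem_partialSums hk)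
    refine ⟨j, ⟨k, hk, by rw [hj, add_comm]⟩, ?_⟩
    rw [← neg_neg i]
    refine hik.neg.trans (Int.modEq_iff_dvd.2 ⟨1, ?_⟩)
    rw [size, hj]
    push_cast
    ring

theorem isSymmetric_iff_isCut_neg {α : Compn} :
    α.IsSymmetric ↔ ∀ i : ℤ, ¬ (α.size : ℤ) ∣ i → (α.IsCut i ↔ α.IsCut (-i)) := by
  constructor
  · intro h i _
    rw [← isCut_reversal, ← h]
  · exact fun h => ext_isCut α.size_reversal.symm fun i hi => (h i hi).trans isCut_reversal.symm

end Cuts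

section Comp

theorem sum_parts_nearConcat (α β : Compn) :
    (α.nearConcat β).parts.sum = (α.parts ++ β.parts).sum := by
  conv_rhs => rw [← List.dropLast_append_getLast α.ne_nil, ← List.cons_head_tail β.ne_nil]
  simp [-List.cons_head_tail, nearConcat, add_assoc]

theorem size_nearConcat (α β : Compn) : (α.nearConcat β).size = α.size + β.size :=
  (sum_parts_nearConcat α β).trans List.sum_append

theorem mem_partialSums_nearConcat {α β : Compn} {i : ℕ} :
    i ∈ (α.nearConcat β).parts.partialSums ↔
      i ≠ α.size ∧ i ∈ (α.parts ++ β.parts).partialSums := by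
  have hsize : α.size = α.parts.dropLast.sum + α.parts.getLast α.ne_nil := by
    rw [size]
    conv_lhs => rw [← List.dropLast_append_getLast α.ne_nil]
    simp
  conv_rhs => rw [← List.dropLast_append_getLast α.ne_nil, ← List.cons_head_tail β.ne_nil, hsize]
  exact mem_partialSums_append_add_cons (α.pos _ (List.getLast_mem _)) (β.pos _ (List.head_mem _))

theorem nearPow_succ (β : Compn) {k : ℕ} (hk : 0 < k) :
    β.nearPow (k + 1) = (β.nearPow k).nearConcat β := by
  obtain ⟨k, rfl⟩ := Nat.exists_eq_add_one.2 hk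
  simp [nearPow, Function.iterate_succ_apply']

theorem size_nearPow (β : Compn) {k : ℕ} (hk : 0 < k) : (β.nearPow k).size = k * β.size := by
  induction k, hk using Nat.le_induction with
  | base => exact (one_mul _).symm
  | succ k hk ih => rw [nearPow_succ β hk, size_nearConcat, ih, add_one_mul]

theorem sum_flatMap_nearPow (β : Compn) {l : List ℕ} (hl : ∀ a ∈ l, 0 < a) :
    (l.flatMap fun a => (β.nearPow a).parts).sum = l.sum * β.size := by
  induction l with
  | nil => simp
  | cons a l ih =>
    rw [List.forall_mem_cons] at hl
    rw [List.flatMap_cons, List.sum_append, ih hl.2, List.sum_cons, add_mul]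
    exact congrArg (· + _) (β.size_nearPow hl.1)

theorem size_comp (α β : Compn) : (comp α β).size = α.size * β.size :=
  sum_flatMap_nearPow β α.pos

theorem mul_mem_partialSums_parts_iff {β : Compn} {i : ℕ} :
    β.size * i ∈ β.parts.partialSums ↔ i = 0 ∨ i = 1 := by
  have hcut : β.IsCut (β.size * i : ℕ) := isCut_of_dvd (by simp)
  rw [mem_partialSums_parts_iff, and_iff_left hcut, mul_le_iff_le_one_right β.one_le_size]
  omega

theorem exists_mem_mul_add_eq_mul_iff {n : ℕ} (hn : 0 < n) {l : List ℕ} {a i : ℕ} :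
    (∃ y ∈ l, n * a + y = n * i) ↔ ∃ j, n * j ∈ l ∧ a + j = i := by
  constructor
  · rintro ⟨y, hy, h⟩
    obtain ⟨j, rfl⟩ : n ∣ y := (Nat.dvd_add_right (dvd_mul_right n a)).1 (h ▸ dvd_mul_right n i)
    exact ⟨j, hy, Nat.eq_of_mul_eq_mul_left hn (mul_add n a j ▸ h)⟩
  · rintro ⟨j, hj, rfl⟩
    exact ⟨n * j, hj, (mul_add n a j).symm⟩

theorem mul_mem_partialSums_nearPow_iff {β : Compn} {k i : ℕ} (hk : 0 < k) :
    β.size * i ∈ (β.nearPow k).parts.partialSums ↔ i = 0 ∨ i = k := by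
  induction k, hk using Nat.le_induction generalizing i with
  | base => exact mul_mem_partialSums_parts_iff
  | succ k hk ih =>
    have hsize : (β.nearPow k).size = β.size * k := (size_nearPow β hk).trans (mul_comm _ _)
    have hsum : (β.nearPow k).parts.sum = β.size * k := hsize
    have hne : β.size * i ≠ β.size * k ↔ i ≠ k := by simp [Nat.one_le_iff_ne_zero.1 β.one_le_size]
    simp only [nearPow_succ β hk, mem_partialSums_nearConcat, mem_partialSums_append, hsize, hsum,
      hne, ih, exists_mem_mul_add_eq_mul_iff β.one_le_size, mul_mem_partialSums_parts_iff,
      or_and_right, exists_or, exists_eq_left]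
    omega

theorem mul_mem_partialSums_flatMap_nearPow_iff {β : Compn} {l : List ℕ} (hl : ∀ a ∈ l, 0 < a)
    {i : ℕ} : β.size * i ∈ (l.flatMap fun a => (β.nearPow a).parts).partialSums ↔
      i ∈ l.partialSums := by
  induction l generalizing i with
  | nil => simp [Nat.one_le_iff_ne_zero.1 β.one_le_size]
  | cons a l ih =>
    rw [List.forall_mem_cons] at hl
    have hsum : (β.nearPow a).parts.sum = β.size * a :=
      (size_nearPow β hl.1).trans (mul_comm _ _)
    have hzero : i = a → ∃ j ∈ l.partialSums, a + j = i :=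
      fun h => ⟨0, zero_mem_partialSums l, h.symm⟩
    simp only [List.flatMap_cons, mem_partialSums_append, mem_partialSums_cons, hsum,
      mul_mem_partialSums_nearPow_iff hl.1, exists_mem_mul_add_eq_mul_iff β.one_le_size, ih hl.2]
    tauto

/-- Between two multiples of the size of `β`, the list `l` has the same breaks as the periodic
repetition of `β`. The breaks at the multiples themselves are unconstrained, so this covers both
`β ⊙ ⋯ ⊙ β` and `β ⋯ β`. -/
def IsTiledBy (β : Compn) (l : List ℕ) : Prop :=
  β.size ∣ l.sum ∧ ∀ i ≤ l.sum, ¬ β.size ∣ i → (i ∈ l.partialSums ↔ β.IsCut i)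

theorem isTiledBy_parts (β : Compn) : β.IsTiledBy β.parts :=
  ⟨dvd_rfl, fun _ hi _ => mem_partialSums_parts_iff.trans (and_iff_right hi)⟩

theorem IsTiledBy.append {β : Compn} {l m : List ℕ} (hl : β.IsTiledBy l) (hm : β.IsTiledBy m) :
    β.IsTiledBy (l ++ m) := by
  rw [IsTiledBy, List.sum_append]
  refine ⟨dvd_add hl.1 hm.1, fun i hi hdvd => ?_⟩
  rw [mem_partialSums_append]
  rcases le_or_gt i l.sum with hil | hli
  · have hnot : ¬ ∃ y ∈ m.partialSums, l.sum + y = i := by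
      rintro ⟨y, -, hy⟩
      exact hdvd ((by omega : l.sum = i) ▸ hl.1)
    rw [or_iff_left hnot, hl.2 i hil hdvd]
  · obtain ⟨j, rfl⟩ := Nat.exists_eq_add_of_le hli.le
    have hnot : l.sum + j ∉ l.partialSums := fun h => hli.not_ge (le_sum_of_mem_partialSums h)
    have hmod : (j : ℤ) ≡ (l.sum + j : ℕ) [ZMOD β.size] := by
      rw [Int.natCast_modEq_iff]
      simpa using (Nat.modEq_zero_iff_dvd.2 hl.1).symm.add_right j
    have hj : ¬ β.size ∣ j := mt (Nat.dvd_add_right hl.1).2 hdvd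
    simp only [hnot, false_or, Nat.add_left_cancel_iff, exists_eq_right]
    rw [hm.2 j (by omega) hj, isCut_congr hmod]

theorem IsTiledBy.nearConcat {α β : Compn} (h : β.IsTiledBy α.parts) :
    β.IsTiledBy (α.nearConcat β).parts := by
  obtain ⟨hdvd, hcut⟩ := h.append β.isTiledBy_parts
  rw [← sum_parts_nearConcat] at hdvd hcut
  refine ⟨hdvd, fun i hi hn => ?_⟩
  have hne : i ≠ α.size := fun hα => hn (hα ▸ h.1)
  rw [mem_partialSums_nearConcat, and_iff_right hne, hcut i hi hn]

theorem isTiledBy_nearPow (β : Compn) {k : ℕ} (hk : 0 < k) : β.IsTiledBy (β.nearPow k).parts := by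
  induction k, hk using Nat.le_induction with
  | base => exact β.isTiledBy_parts
  | succ k hk ih => exact nearPow_succ β hk ▸ ih.nearConcat

theorem isTiledBy_flatMap_nearPow (β : Compn) {l : List ℕ} (hl : ∀ a ∈ l, 0 < a) :
    β.IsTiledBy (l.flatMap fun a => (β.nearPow a).parts) := by
  induction l with
  | nil => exact ⟨dvd_zero _, fun i hi hdvd => absurd (Nat.le_zero.1 hi ▸ dvd_zero _) hdvd⟩
  | cons a l ih =>
    rw [List.forall_mem_cons] at hl
    exact (isTiledBy_nearPow β hl.1).append (ih hl.2)

theorem isCut_comp_mul {α β : Compn} {i : ℤ} : (comp α β).IsCut (β.size * i) ↔ α.IsCut i := by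
  have hβ : (β.size : ℤ) ≠ 0 := Nat.cast_ne_zero.2 (Nat.one_le_iff_ne_zero.1 β.one_le_size)
  simp only [IsCut, size_comp, mul_comm α.size, Nat.cast_mul]
  constructor
  · rintro ⟨j, hj, hij⟩
    obtain ⟨k, rfl⟩ : β.size ∣ j := Int.natCast_dvd_natCast.1
      ((hij.of_mul_right _).dvd_iff.1 (dvd_mul_right _ _))
    exact ⟨k, (mul_mem_partialSums_flatMap_nearPow_iff α.pos).1 hj, hij.mul_left_cancel' hβ⟩
  · rintro ⟨k, hk, hik⟩
    exact ⟨β.size * k, (mul_mem_partialSums_flatMap_nearPow_iff α.pos).2 hk, hik.mul_left'⟩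

theorem isCut_comp_of_not_dvd {α β : Compn} {i : ℤ} (hi : ¬ (β.size : ℤ) ∣ i) :
    (comp α β).IsCut i ↔ β.IsCut i := by
  have hdvd : (β.size : ℤ) ∣ (comp α β).size := ⟨α.size, by rw [size_comp, mul_comm, Nat.cast_mul]⟩
  obtain ⟨j, hj, hij⟩ := (comp α β).exists_natCast_modEq i
  have hj' : ¬ β.size ∣ j := fun h =>
    hi ((hij.of_dvd hdvd).dvd_iff.2 (Int.natCast_dvd_natCast.2 h))
  calc (comp α β).IsCut i ↔ (comp α β).IsCut j := isCut_congr hij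
    _ ↔ j ∈ (comp α β).parts.partialSums := by
      rw [mem_partialSums_parts_iff, and_iff_right hj.le]
    _ ↔ β.IsCut j := (β.isTiledBy_flatMap_nearPow α.pos).2 j hj.le hj'
    _ ↔ β.IsCut i := (isCut_congr (hij.of_dvd hdvd)).symm

end Comp

section Algebra

theorem eq_comp {α β γ : Compn} (hs : γ.size = α.size * β.size)
    (hα : ∀ i : ℤ, γ.IsCut (β.size * i) ↔ α.IsCut i)
    (hβ : ∀ i : ℤ, ¬ (β.size : ℤ) ∣ i → (γ.IsCut i ↔ β.IsCut i)) : γ = comp α β := by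
  refine ext_isCut (hs.trans (size_comp α β).symm) fun i _ => ?_
  by_cases hi : (β.size : ℤ) ∣ i
  · obtain ⟨j, rfl⟩ := hi
    rw [hα, isCut_comp_mul]
  · rw [hβ i hi, isCut_comp_of_not_dvd hi]

theorem comp_inj_of_size_eq {α α' β β' : Compn} (h : comp α β = comp α' β')
    (hs : β.size = β'.size) : α = α' ∧ β = β' := by
  have hsize : α.size = α'.size := by
    have := congrArg size h
    rw [size_comp, size_comp, hs] at this
    exact Nat.eq_of_mul_eq_mul_right β'.one_le_size this
  constructor
  · refine ext_isCut hsize fun i _ => ?_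
    rw [← isCut_comp_mul (β := β), h, hs, isCut_comp_mul]
  · refine ext_isCut hs fun i hi => ?_
    rw [← isCut_comp_of_not_dvd (α := α) hi, h, isCut_comp_of_not_dvd (hs ▸ hi)]

theorem size_one : one.size = 1 := rfl

theorem eq_one_iff {α : Compn} : α = one ↔ α.size = 1 := by
  refine ⟨fun h => h ▸ size_one, fun h => ext_isCut h fun i hi => absurd ?_ hi⟩
  rw [h, Nat.cast_one]
  exact one_dvd i

theorem comp_eq_one_iff {α β : Compn} : comp α β = one ↔ α = one ∧ β = one := by
  simp only [eq_one_iff, size_comp, mul_eq_one]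

theorem comp_one (α : Compn) : comp α one = α :=
  (eq_comp (by rw [size_one, mul_one]) (fun i => by rw [size_one, Nat.cast_one, one_mul])
    fun i hi => absurd (by simp [size_one]) hi).symm

theorem one_comp (α : Compn) : comp one α = α :=
  (eq_comp (by rw [size_one, one_mul])
    (fun i => iff_of_true (isCut_of_dvd (dvd_mul_right _ _)) (isCut_of_dvd (by simp [size_one])))
    fun _ _ => Iff.rfl).symm

theorem comp_assoc (α β γ : Compn) : comp (comp α β) γ = comp α (comp β γ) := by
  have hsize : ((comp β γ).size : ℤ) = γ.size * β.size := by
    rw [size_comp, Nat.cast_mul, mul_comm]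
  refine eq_comp (by simp only [size_comp, mul_assoc]) (fun i => ?_) fun i hi => ?_
  · rw [hsize, mul_assoc, isCut_comp_mul, isCut_comp_mul]
  by_cases hγ : (γ.size : ℤ) ∣ i
  · obtain ⟨j, rfl⟩ := hγ
    have hj : ¬ (β.size : ℤ) ∣ j := fun h => hi (hsize ▸ mul_dvd_mul_left _ h)
    rw [isCut_comp_mul, isCut_comp_mul, isCut_comp_of_not_dvd hj]
  · rw [isCut_comp_of_not_dvd hγ, isCut_comp_of_not_dvd hγ]

theorem reversal_comp (α β : Compn) : (comp α β).reversal = comp α.reversal β.reversal := by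
  refine eq_comp (by simp only [size_comp, size_reversal]) (fun i => ?_) fun i hi => ?_
  · rw [isCut_reversal, isCut_reversal, size_reversal, ← mul_neg, isCut_comp_mul]
  · rw [size_reversal] at hi
    rw [isCut_reversal, isCut_reversal, isCut_comp_of_not_dvd (by rwa [dvd_neg])]

theorem isSymmetric_comp_iff {α β : Compn} :
    (comp α β).IsSymmetric ↔ α.IsSymmetric ∧ β.IsSymmetric := by
  simp only [IsSymmetric, reversal_comp]
  refine ⟨fun h => comp_inj_of_size_eq h β.size_reversal.symm, fun h => ?_⟩
  rw [← h.1, ← h.2]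

end Algebra

section RightFactors

theorem isPeriodicOff_isCut_comp (α β : Compn) : IsPeriodicOff β.size (comp α β).IsCut := by
  intro i j hi hij
  rw [isCut_comp_of_not_dvd hi, isCut_comp_of_not_dvd fun hj => hi (hij.dvd_iff.2 hj),
    isCut_congr hij]

theorem size_dvd_size_comp (α β : Compn) : β.size ∣ (comp α β).size :=
  size_comp α β ▸ dvd_mul_left _ _

theorem exists_eq_comp_of_isPeriodicOff {α : Compn} {n : ℕ} (hdvd : n ∣ α.size)
    (hper : IsPeriodicOff n α.IsCut) : ∃ β γ : Compn, α = comp β γ ∧ γ.size = n := by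
  obtain ⟨k, hk⟩ := hdvd
  have hn : 0 < n := Nat.pos_of_dvd_of_pos ⟨k, hk⟩ α.one_le_size
  have hk0 : 0 < k := Nat.pos_of_dvd_of_pos ⟨n, hk.trans (mul_comm n k)⟩ α.one_le_size
  have hdvd_iff (i : ℤ) : (α.size : ℤ) ∣ n * i ↔ (k : ℤ) ∣ i := by
    rw [hk, Nat.cast_mul]
    exact mul_dvd_mul_iff_left (by positivity)
  obtain ⟨γ, hγ, hγcut⟩ := exists_isCut_iff hn hper
  have hper' : IsPeriodicOff k fun i => α.IsCut (n * i) := fun i j _ hij => isCut_congr <| by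
    rw [hk, Nat.cast_mul]
    exact hij.mul_left'
  obtain ⟨β, hβ, hβcut⟩ := exists_isCut_iff hk0 hper'
  refine ⟨β, γ, eq_comp (by rw [hβ, hγ, hk, mul_comm]) (fun i => ?_) fun i hi => ?_, hγ⟩
  · rw [hγ]
    by_cases hi : (k : ℤ) ∣ i
    · exact iff_of_true (isCut_of_dvd ((hdvd_iff i).2 hi)) (isCut_of_dvd (hβ ▸ hi))
    · exact (hβcut i hi).symm
  · exact (hγcut i (hγ ▸ hi)).symm

theorem exists_comp_of_dvd {α β α' β' : Compn} (h : comp α β = comp α' β')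
    (hdvd : β.size ∣ β'.size) : ∃ δ, α = comp α' δ ∧ β' = comp δ β := by
  have hper : IsPeriodicOff β.size β'.IsCut := fun i j hi hij => by
    have hdvd' : (β.size : ℤ) ∣ β'.size := mod_cast hdvd
    have hj : ¬ (β.size : ℤ) ∣ j := fun hj => hi (hij.dvd_iff.2 hj)
    rw [← isCut_comp_of_not_dvd (α := α') fun h => hi (hdvd'.trans h),
      ← isCut_comp_of_not_dvd (α := α') fun h => hj (hdvd'.trans h), ← h]
    exact isPeriodicOff_isCut_comp α β i j hi hij
  obtain ⟨δ, ε, rfl, hε⟩ := exists_eq_comp_of_isPeriodicOff hdvd hper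
  rw [← comp_assoc] at h
  obtain ⟨hα, rfl⟩ := comp_inj_of_size_eq h hε.symm
  exact ⟨δ, hα, rfl⟩

theorem exists_eq_comp_gcd {α β α' β' : Compn} (h : comp α β = comp α' β') :
    ∃ γ δ, comp α β = comp γ δ ∧ δ.size = β.size.gcd β'.size :=
  exists_eq_comp_of_isPeriodicOff ((Nat.gcd_dvd_left _ _).trans (size_dvd_size_comp α β))
    ((isPeriodicOff_isCut_comp α β).gcd (h ▸ isPeriodicOff_isCut_comp α' β'))

theorem exists_eq_comp_lcm {α β α' β' : Compn} (h : comp α β = comp α' β') :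
    ∃ γ δ, comp α β = comp γ δ ∧ δ.size = β.size.lcm β'.size :=
  exists_eq_comp_of_isPeriodicOff
    (Nat.lcm_dvd (size_dvd_size_comp α β) (h ▸ size_dvd_size_comp α' β'))
    ((isPeriodicOff_isCut_comp α β).lcm (h ▸ isPeriodicOff_isCut_comp α' β'))

end RightFactors

section Uniform

theorem size_comp_dvd_mul_iff {α β : Compn} {i : ℤ} :
    ((comp α β).size : ℤ) ∣ β.size * i ↔ (α.size : ℤ) ∣ i := by
  rw [size_comp, mul_comm, Nat.cast_mul]
  exact mul_dvd_mul_iff_left (Nat.cast_ne_zero.2 (Nat.one_le_iff_ne_zero.1 β.one_le_size))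

/-- Every integer that is not a multiple of the size is a cut (`b = true`), or none is
(`b = false`). These are the compositions with all components equal to `1`, and the compositions of
length `1`, respectively; the Boolean lets both kinds be treated at once. -/
def IsUniform (b : Bool) (α : Compn) : Prop :=
  ∀ i : ℤ, ¬ (α.size : ℤ) ∣ i → (α.IsCut i ↔ b = true)

variable {b b' : Bool} {α β : Compn}

theorem isUniform_one (b : Bool) : one.IsUniform b :=
  fun i hi => absurd (by simp [size_one]) hi

theorem IsUniform.eq_of_size_eq (hα : α.IsUniform b) (hβ : β.IsUniform b)
    (h : α.size = β.size) : α = β :=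
  ext_isCut h fun i hi => (hα i hi).trans (hβ i (h ▸ hi)).symm

theorem exists_isUniform (b : Bool) {n : ℕ} (hn : 0 < n) :
    ∃ α : Compn, α.size = n ∧ α.IsUniform b := by
  obtain ⟨α, rfl, hα⟩ := exists_isCut_iff hn (p := fun _ => b = true) fun _ _ _ _ => Iff.rfl
  exact ⟨α, rfl, hα⟩

theorem IsUniform.bool_eq (h : α.IsUniform b) (h' : α.IsUniform b') (hα : α ≠ one) : b = b' := by
  have h1 : ¬ (α.size : ℤ) ∣ 1 := by
    rwa [Int.natCast_dvd_ofNat, Nat.dvd_one, ← eq_one_iff]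
  exact Bool.eq_iff_iff.2 ((h 1 h1).symm.trans (h' 1 h1))

theorem IsUniform.isSymmetric (h : α.IsUniform b) : α.IsSymmetric :=
  isSymmetric_iff_isCut_neg.2 fun i hi => (h i hi).trans (h (-i) (by rwa [dvd_neg])).symm

theorem isUniform_false_of_length_eq_one (h : α.length = 1) : α.IsUniform false := by
  obtain ⟨a, ha⟩ := List.length_eq_one_iff.1 h
  have hsize : α.size = a := by simp [size, ha]
  refine fun i hi => iff_of_false ?_ Bool.false_ne_true
  rintro ⟨j, hj, hij⟩
  refine hi (hij.dvd_iff.2 ?_)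
  rw [ha, mem_partialSums_cons, List.partialSums_nil] at hj
  rcases hj with rfl | ⟨_, hy, rfl⟩
  · exact dvd_zero _
  · simp [List.mem_singleton.1 hy, hsize]

theorem AllOnes.isUniform_true (h : α.AllOnes) : α.IsUniform true := by
  refine fun i _ => iff_of_true ?_ rfl
  obtain ⟨j, hj, hij⟩ := α.exists_natCast_modEq i
  have hparts : α.parts = List.replicate α.length 1 := List.eq_replicate_of_mem h
  have hlen : α.size = α.length := by rw [size, hparts]; simp
  refine ⟨j, mem_partialSums_iff_exists_append.2
    ⟨List.replicate j 1, List.replicate (α.length - j) 1, ?_, by simp⟩, hij⟩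
  rw [hparts, ← List.replicate_add, Nat.add_sub_cancel' (hlen ▸ hj.le)]

theorem length_eq_one_iff : α.length = 1 ↔ α.IsUniform false := by
  refine ⟨isUniform_false_of_length_eq_one, fun h => ?_⟩
  let β : Compn := ⟨[α.size], by simp, List.forall_mem_singleton.2 α.one_le_size⟩
  have hβ : β.IsUniform false := isUniform_false_of_length_eq_one rfl
  rw [h.eq_of_size_eq hβ List.sum_singleton.symm]
  rfl

theorem allOnes_iff : α.AllOnes ↔ α.IsUniform true := by
  refine ⟨AllOnes.isUniform_true, fun h => ?_⟩
  let β : Compn := ⟨List.replicate α.size 1,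
    by simpa using Nat.one_le_iff_ne_zero.1 α.one_le_size, by simp⟩
  have hβ : β.AllOnes := fun a ha => List.eq_of_mem_replicate ha
  rwa [h.eq_of_size_eq hβ.isUniform_true (by simp [β, size])]

theorem isTrivialPair_iff :
    IsTrivialPair α β ↔ α = one ∨ β = one ∨ ∃ b, α.IsUniform b ∧ β.IsUniform b := by
  simp [IsTrivialPair, length_eq_one_iff, allOnes_iff, or_assoc]

theorem isIrreducible_iff :
    α.IsIrreducible ↔ (∀ b, ¬ α.IsUniform b) ∧ α.OnlyTrivialFactorisations := by
  simp [IsIrreducible, length_eq_one_iff, allOnes_iff, and_assoc]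

theorem isUniform_left_iff (β : Compn) : α.IsUniform b ↔ ∀ i : ℤ, (β.size : ℤ) ∣ i →
    ¬ ((comp α β).size : ℤ) ∣ i → ((comp α β).IsCut i ↔ b = true) := by
  constructor
  · rintro h _ ⟨i, rfl⟩ hi
    rw [isCut_comp_mul, h i (mt size_comp_dvd_mul_iff.2 hi)]
  · intro h i hi
    rw [← isCut_comp_mul, h _ (dvd_mul_right _ _) (mt size_comp_dvd_mul_iff.1 hi)]

theorem isUniform_comp_iff : (comp α β).IsUniform b ↔ α.IsUniform b ∧ β.IsUniform b := by
  constructor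
  · refine fun h => ⟨(isUniform_left_iff β).2 fun i _ => h i, fun i hi => ?_⟩
    rw [← isCut_comp_of_not_dvd hi]
    exact h i fun hi' => hi (.trans (mod_cast size_dvd_size_comp α β) hi')
  · rintro ⟨hα, hβ⟩ i hi
    by_cases hdvd : (β.size : ℤ) ∣ i
    · exact (isUniform_left_iff β).1 hα i hdvd hi
    · rw [isCut_comp_of_not_dvd hdvd, hβ i hdvd]

theorem IsUniform.onlyTrivialFactorisations (h : α.IsUniform b) : α.OnlyTrivialFactorisations := by
  rintro β γ rfl
  exact isTrivialPair_iff.2 (Or.inr (Or.inr ⟨b, isUniform_comp_iff.1 h⟩))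

theorem OnlyTrivialFactorisations.isIrreducible_or (h : α.OnlyTrivialFactorisations) :
    α.IsIrreducible ∨ ∃ b, α.IsUniform b := by
  rw [isIrreducible_iff, ← not_exists]
  exact (em _).symm.imp_left fun hα => ⟨hα, h⟩

end Uniform

section IrreducibleLeftFactors

variable {α β α' β' π f : Compn}

theorem IsIrreducible.ne_one (h : π.IsIrreducible) : π ≠ one := by
  rintro rfl
  exact (isIrreducible_iff.1 h).1 true (isUniform_one true)

theorem IsIrreducible.eq_one_or_eq_one (h : (comp α β).IsIrreducible) : α = one ∨ β = one := by
  rw [isIrreducible_iff] at h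
  rcases isTrivialPair_iff.1 (h.2 α β rfl) with hα | hβ | ⟨b, hb⟩
  · exact Or.inl hα
  · exact Or.inr hβ
  · exact absurd (isUniform_comp_iff.2 hb) (h.1 b)

-- By the Chinese remainder theorem, all multiples of one size that are not multiples of the other
-- are either cuts or not cuts together; the lcm being full, these are all the internal ones.
theorem isCut_iff_isCut_size_of_dvd_lcm (h : comp α β = comp α' β')
    (hlcm : (comp α β).size ∣ β.size.lcm β'.size) (hββ' : ¬ β.size ∣ β'.size) {i : ℤ}
    (hdvd : (β.size : ℤ) ∣ i) (hi : ¬ ((comp α β).size : ℤ) ∣ i) :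
    (comp α β).IsCut i ↔ (comp α β).IsCut β'.size := by
  refine (isPeriodicOff_isCut_comp α β).iff_of_dvd_of_dvd (h ▸ isPeriodicOff_isCut_comp α' β')
    hdvd (fun hi' => hi ?_) dvd_rfl (mod_cast hββ')
  exact .trans (mod_cast hlcm) (Int.coe_lcm_dvd hdvd hi')

theorem IsIrreducible.size_dvd_or_size_dvd (hπ : π.IsIrreducible) (h : comp π β = comp α' β') :
    β.size ∣ β'.size ∨ β'.size ∣ β.size := by
  by_contra! hnot
  obtain ⟨γ, ε, hε, hsize⟩ := exists_eq_comp_lcm h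
  obtain ⟨δ, rfl, rfl⟩ := exists_comp_of_dvd hε (hsize ▸ Nat.dvd_lcm_left _ _)
  rcases hπ.eq_one_or_eq_one with rfl | rfl
  · rw [one_comp] at hπ hε h
    classical
    refine (isIrreducible_iff.1 hπ).1 (decide ((comp δ β).IsCut β'.size))
      ((isUniform_left_iff β).2 fun i hdvd hi => ?_)
    rw [isCut_iff_isCut_size_of_dvd_lcm h hsize.dvd hnot.1 hdvd hi, decide_eq_true_iff]
  · rw [one_comp] at hsize
    exact hnot.2 (hsize ▸ Nat.dvd_lcm_right _ _)

theorem IsIrreducible.comp_inj (hπ : π.IsIrreducible) (hf : f.OnlyTrivialFactorisations)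
    (hf1 : f ≠ one) (h : comp π β = comp f β') : π = f ∧ β = β' := by
  suffices hsize : β.size = β'.size from comp_inj_of_size_eq h hsize
  rcases hπ.size_dvd_or_size_dvd h with hdvd | hdvd
  · obtain ⟨δ, rfl, rfl⟩ := exists_comp_of_dvd h hdvd
    rw [hπ.eq_one_or_eq_one.resolve_left hf1, one_comp]
  · obtain ⟨δ, rfl, rfl⟩ := exists_comp_of_dvd h.symm hdvd
    rcases isTrivialPair_iff.1 (hf π δ rfl) with h1 | rfl | ⟨b, hb, -⟩
    · exact absurd h1 hπ.ne_one
    · rw [one_comp]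
    · exact absurd hb ((isIrreducible_iff.1 hπ).1 b)

theorem one_lt_size_iff : 1 < α.size ↔ α ≠ one := by
  rw [Ne, eq_one_iff]
  exact ⟨ne_of_gt, α.one_le_size.lt_of_ne'⟩

theorem size_lt_size_comp_left (hβ : β ≠ one) : α.size < (comp α β).size := by
  rw [size_comp]
  exact lt_mul_of_one_lt_right α.one_le_size (one_lt_size_iff.2 hβ)

theorem size_lt_size_comp_right (hα : α ≠ one) : β.size < (comp α β).size := by
  rw [size_comp]
  exact lt_mul_of_one_lt_left β.one_le_size (one_lt_size_iff.2 hα)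

theorem not_size_comp_dvd_size (hα : α ≠ one) : ¬ (comp α β).size ∣ β.size :=
  fun h => (size_lt_size_comp_right hα).not_ge (Nat.le_of_dvd β.one_le_size h)

theorem exists_left_factor {α : Compn} (h : α ≠ one) :
    ∃ f β, f ≠ one ∧ f.OnlyTrivialFactorisations ∧ α = comp f β := by
  induction hn : α.size using Nat.strong_induction_on generalizing α with
  | _ n ih =>
    subst hn
    by_cases hα : α.OnlyTrivialFactorisations
    · exact ⟨α, one, h, hα, (comp_one α).symm⟩
    simp only [OnlyTrivialFactorisations, not_forall] at hα
    obtain ⟨β, γ, rfl, hnot⟩ := hα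
    rw [isTrivialPair_iff, not_or, not_or] at hnot
    obtain ⟨f, δ, hf1, hf, rfl⟩ := ih _ (size_lt_size_comp_left hnot.2.1) hnot.1 rfl
    exact ⟨f, comp δ γ, hf1, hf, comp_assoc f δ γ⟩

end IrreducibleLeftFactors

section UniformLeftFactors

/-- `α` has a nontrivial left factor of the kind `b`. -/
def HasUniformLeft (b : Bool) (α : Compn) : Prop :=
  ∃ κ β, κ ≠ one ∧ κ.IsUniform b ∧ α = comp κ β

variable {b b' : Bool} {α β κ κ' β' π : Compn}

theorem not_hasUniformLeft_one (b : Bool) : ¬ one.HasUniformLeft b := by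
  rintro ⟨κ, β, hκ, -, h⟩
  exact hκ (comp_eq_one_iff.1 h.symm).1

theorem IsUniform.eq_one_of_not_hasUniformLeft (hκ : κ.IsUniform b)
    (h : ¬ (comp κ β).HasUniformLeft b) : κ = one := by
  by_contra hκ1
  exact h ⟨κ, β, hκ1, hκ, rfl⟩

theorem IsIrreducible.not_hasUniformLeft_comp (hπ : π.IsIrreducible) (b : Bool) (β : Compn) :
    ¬ (comp π β).HasUniformLeft b := by
  rintro ⟨κ, γ, hκ1, hκ, h⟩
  obtain ⟨rfl, -⟩ := hπ.comp_inj hκ.onlyTrivialFactorisations hκ1 h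
  exact (isIrreducible_iff.1 hπ).1 b hκ

theorem HasUniformLeft.bool_eq (h : α.HasUniformLeft b) (h' : α.HasUniformLeft b') : b = b' := by
  obtain ⟨κ, β, hκ1, hκ, rfl⟩ := h
  obtain ⟨κ', β', hκ1', hκ', h⟩ := h'
  obtain ⟨γ, ε, hε, hsize⟩ := exists_eq_comp_lcm h
  obtain ⟨δ, hδ, -⟩ := exists_comp_of_dvd hε (hsize ▸ Nat.dvd_lcm_left _ _)
  obtain ⟨δ', hδ', -⟩ := exists_comp_of_dvd (h.symm.trans hε) (hsize ▸ Nat.dvd_lcm_right _ _)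
  by_cases hγ : γ = one
  · have hlcm : (comp κ β).size ∣ β.size.lcm β'.size := by rw [hε, hγ, one_comp, hsize]
    have hββ' : ¬ β.size ∣ β'.size := fun hdvd =>
      not_size_comp_dvd_size hκ1' (by rwa [Nat.lcm_eq_right hdvd, h] at hlcm)
    have hβ : ¬ ((comp κ β).size : ℤ) ∣ β.size := mod_cast not_size_comp_dvd_size hκ1
    have hβ' : ¬ ((comp κ' β').size : ℤ) ∣ β'.size := mod_cast not_size_comp_dvd_size hκ1'
    rw [Bool.eq_iff_iff, ← (isUniform_left_iff β).1 hκ _ dvd_rfl hβ,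
      ← (isUniform_left_iff β').1 hκ' _ dvd_rfl hβ', ← h]
    exact isCut_iff_isCut_size_of_dvd_lcm h hlcm hββ' dvd_rfl hβ
  · exact (isUniform_comp_iff.1 (hδ ▸ hκ)).1.bool_eq (isUniform_comp_iff.1 (hδ' ▸ hκ')).1 hγ

theorem exists_uniform_comp (b : Bool) (α : Compn) :
    ∃ κ β, κ.IsUniform b ∧ ¬ β.HasUniformLeft b ∧ α = comp κ β := by
  induction hn : α.size using Nat.strong_induction_on generalizing α with
  | _ n ih =>
    subst hn
    by_cases hα : α.HasUniformLeft b
    · obtain ⟨κ, β, hκ1, hκ, rfl⟩ := hα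
      obtain ⟨κ', γ, hκ', hγ, rfl⟩ := ih _ (size_lt_size_comp_right hκ1) β rfl
      exact ⟨comp κ κ', γ, isUniform_comp_iff.2 ⟨hκ, hκ'⟩, hγ, (comp_assoc κ κ' γ).symm⟩
    · exact ⟨one, α, isUniform_one b, hα, (one_comp α).symm⟩

theorem IsUniform.exists_isUniform_comp_gcd (hκ : κ.IsUniform b) (hκ' : κ'.IsUniform b)
    (h : comp κ β = comp κ' β') :
    ∃ γ ε, γ.IsUniform b ∧ comp κ β = comp γ ε ∧ ε.size = β.size.gcd β'.size := by
  obtain ⟨γ, ε, hε, hsize⟩ := exists_eq_comp_gcd h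
  refine ⟨γ, ε, (isUniform_left_iff ε).2 fun i hdvd hi => ?_, hε, hsize⟩
  rw [hsize] at hdvd
  rw [← hε] at hi ⊢
  by_cases hβ : (β.size : ℤ) ∣ i
  · exact (isUniform_left_iff β).1 hκ i hβ hi
  obtain ⟨k, hik, hk⟩ := exists_modEq_and_modEq (Int.modEq_zero_iff_dvd.2 hdvd)
  have hβk : ¬ (β.size : ℤ) ∣ k := mt hik.dvd_iff.2 hβ
  have hk' : ¬ ((comp κ β).size : ℤ) ∣ k := fun h' =>
    hβk (.trans (mod_cast size_dvd_size_comp κ β) h')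
  rw [isPeriodicOff_isCut_comp κ β i k hβ hik]
  rw [h] at hk' ⊢
  exact (isUniform_left_iff β').1 hκ' k (Int.modEq_zero_iff_dvd.1 hk) hk'

theorem IsUniform.comp_inj (hκ : κ.IsUniform b) (hκ' : κ'.IsUniform b)
    (hβ : ¬ β.HasUniformLeft b) (hβ' : ¬ β'.HasUniformLeft b) (h : comp κ β = comp κ' β') :
    κ = κ' ∧ β = β' := by
  obtain ⟨γ, ε, hγ, hε, hsize⟩ := hκ.exists_isUniform_comp_gcd hκ' h
  have right_eq : ∀ {κ β : Compn}, ¬ β.HasUniformLeft b → comp γ ε = comp κ β →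
      ε.size ∣ β.size → β = ε := by
    intro κ β hβ h hdvd
    obtain ⟨δ, rfl, rfl⟩ := exists_comp_of_dvd h hdvd
    rw [(isUniform_comp_iff.1 hγ).2.eq_one_of_not_hasUniformLeft hβ, one_comp]
  obtain rfl := right_eq hβ hε.symm (hsize ▸ Nat.gcd_dvd_left _ _)
  obtain rfl := right_eq hβ' (hε.symm.trans h) (hsize ▸ Nat.gcd_dvd_right _ _)
  exact comp_inj_of_size_eq h rfl

theorem forall_not_hasUniformLeft_iff :
    (∀ b, ¬ α.HasUniformLeft b) ↔ α = one ∨ ∃ π β, π.IsIrreducible ∧ α = comp π β := by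
  constructor
  · intro h
    refine or_iff_not_imp_left.2 fun hα => ?_
    obtain ⟨f, β, hf1, hf, rfl⟩ := exists_left_factor hα
    rcases hf.isIrreducible_or with hf | ⟨b, hf⟩
    · exact ⟨f, β, hf, rfl⟩
    · exact absurd ⟨f, β, hf1, hf, rfl⟩ (h b)
  · rintro (rfl | ⟨π, β, hπ, rfl⟩) b
    · exact not_hasUniformLeft_one b
    · exact hπ.not_hasUniformLeft_comp b β

end UniformLeftFactors

section Normalised

variable {b : Bool} {α β π κ f g : Compn} {t : List Compn}

theorem IsSymmetric.isLexMinimal (h : α.IsSymmetric) : α.IsLexMinimal :=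
  (congrArg parts h).le

theorem OnlyTrivialFactorisations.isNormalised (hf : f.OnlyTrivialFactorisations)
    (hmin : f.IsLexMinimal) : f.IsNormalised :=
  ⟨[f], ⟨List.cons_ne_nil _ _, (comp_one f).symm, List.isChain_singleton f,
    List.forall_mem_singleton.2 hf⟩, List.forall_mem_singleton.2 hmin⟩

theorem IsUniform.isNormalised (h : α.IsUniform b) : α.IsNormalised :=
  h.onlyTrivialFactorisations.isNormalised h.isSymmetric.isLexMinimal

namespace IsIrreducibleFactorisation

theorem eq_comp (h : IsIrreducibleFactorisation (f :: t) α) : α = comp f (t.foldr comp one) :=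
  h.2.1

theorem onlyTrivialFactorisations (h : IsIrreducibleFactorisation (f :: t) α) :
    f.OnlyTrivialFactorisations :=
  h.2.2.2 f List.mem_cons_self

theorem head_ne_one (h : IsIrreducibleFactorisation (f :: t) α) (hα : α ≠ one) : f ≠ one := by
  rintro rfl
  cases t with
  | nil => exact hα (h.eq_comp.trans (comp_one _))
  | cons g t => exact (List.isChain_cons_cons.1 h.2.2.1).1 (Or.inl (Or.inl rfl))

theorem tail (h : IsIrreducibleFactorisation (f :: g :: t) α) :
    IsIrreducibleFactorisation (g :: t) ((g :: t).foldr comp one) :=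
  ⟨List.cons_ne_nil _ _, rfl, (List.isChain_cons_cons.1 h.2.2.1).2,
    (List.forall_mem_cons.1 h.2.2.2).2⟩

theorem cons (h : IsIrreducibleFactorisation (g :: t) β) (hf : f.OnlyTrivialFactorisations)
    (hfg : ¬ IsTrivialPair f g) : IsIrreducibleFactorisation (f :: g :: t) (comp f β) :=
  ⟨List.cons_ne_nil _ _, congrArg (comp f) h.2.1, List.isChain_cons_cons.2 ⟨hfg, h.2.2.1⟩,
    List.forall_mem_cons.2 ⟨hf, h.2.2.2⟩⟩

theorem head_isUniform (h : IsIrreducibleFactorisation (f :: t) α) (hα : α.HasUniformLeft b) :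
    f.IsUniform b := by
  have hf1 : f ≠ one := h.head_ne_one fun hα1 => not_hasUniformLeft_one b (hα1 ▸ hα)
  rcases h.onlyTrivialFactorisations.isIrreducible_or with hf | ⟨b', hf⟩
  · exact absurd (h.eq_comp ▸ hα) (hf.not_hasUniformLeft_comp b _)
  · rwa [hα.bool_eq ⟨f, _, hf1, hf, h.eq_comp⟩]

theorem not_hasUniformLeft_tail (h : IsIrreducibleFactorisation (f :: t) α)
    (hf : f.IsUniform b) : ¬ (t.foldr comp one).HasUniformLeft b := by
  intro ht
  cases t with
  | nil => exact not_hasUniformLeft_one b ht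
  | cons g t =>
    exact (List.isChain_cons_cons.1 h.2.2.1).1
      (isTrivialPair_iff.2 (Or.inr (Or.inr ⟨b, hf, h.tail.head_isUniform ht⟩)))

end IsIrreducibleFactorisation

theorem IsNormalised.exists_comp (h : α.IsNormalised) (hα : α ≠ one) :
    ∃ f β, f ≠ one ∧ f.OnlyTrivialFactorisations ∧ f.IsLexMinimal ∧ β.IsNormalised ∧
      (∀ b, f.IsUniform b → ¬ β.HasUniformLeft b) ∧ α = comp f β := by
  obtain ⟨fs, h, hmin⟩ := h
  obtain ⟨f, t, rfl⟩ := List.exists_cons_of_ne_nil h.1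
  rw [List.forall_mem_cons] at hmin
  refine ⟨f, t.foldr comp one, h.head_ne_one hα, h.onlyTrivialFactorisations, hmin.1, ?_,
    fun b hb => h.not_hasUniformLeft_tail hb, h.eq_comp⟩
  cases t with
  | nil => exact (isUniform_one true).isNormalised
  | cons g t => exact ⟨g :: t, h.tail, hmin.2⟩

theorem IsNormalised.comp_left (h : β.IsNormalised) (hf : f.OnlyTrivialFactorisations)
    (hmin : f.IsLexMinimal) (hfβ : ∀ b, f.IsUniform b → ¬ β.HasUniformLeft b) :
    (comp f β).IsNormalised := by
  by_cases hf1 : f = one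
  · rwa [hf1, one_comp]
  by_cases hβ : β = one
  · rw [hβ, comp_one]
    exact hf.isNormalised hmin
  obtain ⟨fs, h, hmin'⟩ := h
  obtain ⟨g, t, rfl⟩ := List.exists_cons_of_ne_nil h.1
  have hg1 : g ≠ one := h.head_ne_one hβ
  refine ⟨f :: g :: t, h.cons hf fun htriv => ?_, List.forall_mem_cons.2 ⟨hmin, hmin'⟩⟩
  rcases isTrivialPair_iff.1 htriv with hf1' | hg1' | ⟨b, hfb, hgb⟩
  · exact hf1 hf1'
  · exact hg1 hg1'
  · exact hfβ b hfb ⟨g, _, hg1, hgb, h.eq_comp⟩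

theorem IsIrreducible.isNormalised_comp_iff (hπ : π.IsIrreducible) :
    (comp π β).IsNormalised ↔ π.IsLexMinimal ∧ β.IsNormalised := by
  constructor
  · intro h
    have hne : comp π β ≠ one := fun h1 => hπ.ne_one (comp_eq_one_iff.1 h1).1
    obtain ⟨f, γ, hf1, hf, hmin, hγ, -, hfγ⟩ := h.exists_comp hne
    obtain ⟨rfl, rfl⟩ := hπ.comp_inj hf hf1 hfγ
    exact ⟨hmin, hγ⟩
  · rintro ⟨hmin, hβ⟩
    exact hβ.comp_left hπ.2.2 hmin fun b hb => absurd hb ((isIrreducible_iff.1 hπ).1 b)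

theorem IsIrreducible.isNormalised_iff (hπ : π.IsIrreducible) :
    π.IsNormalised ↔ π.IsLexMinimal := by
  rw [← and_iff_left (a := π.IsLexMinimal) (isUniform_one true).isNormalised,
    ← hπ.isNormalised_comp_iff, comp_one]

theorem IsUniform.isNormalised_comp_iff_of_not_hasUniformLeft (hκ : κ.IsUniform b)
    (hβ : ¬ β.HasUniformLeft b) : (comp κ β).IsNormalised ↔ β.IsNormalised := by
  by_cases hκ1 : κ = one
  · rw [hκ1, one_comp]
  constructor
  · intro h
    have hne : comp κ β ≠ one := fun h1 => hκ1 (comp_eq_one_iff.1 h1).1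
    have hleft : (comp κ β).HasUniformLeft b := ⟨κ, β, hκ1, hκ, rfl⟩
    obtain ⟨f, γ, hf1, hf, -, hγ, hfγ, hcomp⟩ := h.exists_comp hne
    rcases hf.isIrreducible_or with hf | ⟨b', hf⟩
    · exact absurd (hcomp ▸ hleft) (hf.not_hasUniformLeft_comp b γ)
    · obtain rfl := hleft.bool_eq ⟨f, γ, hf1, hf, hcomp⟩
      rwa [(hκ.comp_inj hf hβ (hfγ b hf) hcomp).2]
  · intro h
    refine h.comp_left hκ.onlyTrivialFactorisations hκ.isSymmetric.isLexMinimal fun b' hb' => ?_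
    rwa [hb'.bool_eq hκ hκ1]

theorem IsUniform.isNormalised_comp_iff (hκ : κ.IsUniform b) :
    (comp κ β).IsNormalised ↔ β.IsNormalised := by
  obtain ⟨δ, γ, hδ, hγ, rfl⟩ := exists_uniform_comp b β
  have hκδ : (comp κ δ).IsUniform b := isUniform_comp_iff.2 ⟨hκ, hδ⟩
  rw [← comp_assoc, hκδ.isNormalised_comp_iff_of_not_hasUniformLeft hγ,
    hδ.isNormalised_comp_iff_of_not_hasUniformLeft hγ]

/-- Membership in `X` is decided on the factors of an irreducible factorisation, the factors of
length `1` and those with all components equal to `1` being always allowed. -/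
structure IsMultiplicative (X : Set Compn) : Prop where
  mem_of_isUniform : ∀ {b : Bool} {κ : Compn}, κ.IsUniform b → κ ∈ X
  comp_mem_iff : ∀ {f β : Compn}, f.OnlyTrivialFactorisations →
    (comp f β ∈ X ↔ f ∈ X ∧ β ∈ X)

theorem isMultiplicative_isSymmetric : IsMultiplicative {α | α.IsSymmetric} where
  mem_of_isUniform hκ := hκ.isSymmetric
  comp_mem_iff _ := isSymmetric_comp_iff

theorem isMultiplicative_isNormalised : IsMultiplicative {α | α.IsNormalised} where
  mem_of_isUniform hκ := hκ.isNormalised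
  comp_mem_iff hf := by
    rcases hf.isIrreducible_or with hf | ⟨b, hf⟩
    · exact hf.isNormalised_comp_iff.trans (and_congr_left' hf.isNormalised_iff.symm)
    · exact hf.isNormalised_comp_iff.trans (and_iff_right hf.isNormalised).symm

end Normalised

section DirichletSeries

open ArithmeticFunction (zeta)

variable {A B C X : Set Compn}

theorem dgf_apply (A : Set Compn) (n : ℕ) :
    dgf A n = ({α : Compn | α ∈ A ∧ α.size = n}.ncard : ℤ) := rfl

theorem finite_mem_size_eq (A : Set Compn) (n : ℕ) : {α : Compn | α ∈ A ∧ α.size = n}.Finite :=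
  (finite_size_eq n).subset fun _ h => h.2

theorem dgf_union_add_dgf_inter (A B : Set Compn) :
    dgf (A ∪ B) + dgf (A ∩ B) = dgf A + dgf B := by
  ext n
  have hunion : {α : Compn | α ∈ A ∪ B ∧ α.size = n} =
      {α | α ∈ A ∧ α.size = n} ∪ {α | α ∈ B ∧ α.size = n} :=
    Set.union_inter_distrib_right A B {α | α.size = n}
  have hinter : {α : Compn | α ∈ A ∩ B ∧ α.size = n} =
      {α | α ∈ A ∧ α.size = n} ∩ {α | α ∈ B ∧ α.size = n} :=
    Set.inter_inter_distrib_right A B {α | α.size = n}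
  simp only [ArithmeticFunction.add_apply, dgf_apply, hunion, hinter]
  exact mod_cast Set.ncard_union_add_ncard_inter _ _ (finite_mem_size_eq A n)
    (finite_mem_size_eq B n)

theorem dgf_empty : dgf ∅ = 0 := by
  ext n
  simp [dgf_apply]

theorem dgf_union_of_disjoint (h : Disjoint A B) : dgf (A ∪ B) = dgf A + dgf B := by
  rw [← dgf_union_add_dgf_inter, h.inter_eq, dgf_empty, add_zero]

theorem dgf_eq_ite {p : ℕ → Prop} [DecidablePred p]
    (hA : ∀ α ∈ A, ∀ β ∈ A, α.size = β.size → α = β)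
    (hp : ∀ n, p n ↔ ∃ α ∈ A, α.size = n) (n : ℕ) : dgf A n = if p n then 1 else 0 := by
  rw [dgf_apply]
  split_ifs with h
  · obtain ⟨α, hα, rfl⟩ := (hp n).1 h
    rw [Nat.cast_eq_one, Set.ncard_eq_one]
    exact ⟨α, Set.eq_singleton_iff_unique_mem.2
      ⟨⟨hα, rfl⟩, fun β hβ => hA β hβ.1 α hα hβ.2⟩⟩
  · rw [Nat.cast_eq_zero, Set.ncard_eq_zero (finite_mem_size_eq A n)]
    exact Set.eq_empty_of_forall_notMem fun α hα => h ((hp n).2 ⟨α, hα⟩)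

theorem dgf_singleton_one : dgf {one} = 1 := by
  ext n
  rw [ArithmeticFunction.one_apply]
  refine dgf_eq_ite (p := (· = 1)) ?_ (fun n => ?_) n
  · rintro _ rfl _ rfl -
    rfl
  · simp [size_one, eq_comm]

theorem dgf_isUniform (b : Bool) : dgf {α | α.IsUniform b} = (zeta : ArithmeticFunction ℤ) := by
  ext n
  rw [ArithmeticFunction.natCoe_apply, ArithmeticFunction.zeta_apply, ← ite_not, Nat.cast_ite,
    Nat.cast_one, Nat.cast_zero]
  refine dgf_eq_ite (p := (· ≠ 0)) (fun α hα β hβ => hα.eq_of_size_eq hβ)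
    (fun n => ⟨fun hn => ?_, ?_⟩) n
  · obtain ⟨α, hα, hαb⟩ := exists_isUniform b (Nat.pos_of_ne_zero hn)
    exact ⟨α, hαb, hα⟩
  · rintro ⟨α, -, rfl⟩
    exact Nat.one_le_iff_ne_zero.1 α.one_le_size

theorem dgf_mul_of_bijOn (h : Set.BijOn (fun x : Compn × Compn => comp x.1 x.2) (A ×ˢ B) C) :
    dgf A * dgf B = dgf C := by
  classical
  ext n
  rcases Nat.eq_zero_or_pos n with rfl | hn
  · simp only [ArithmeticFunction.map_zero]
  simp only [ArithmeticFunction.mul_apply, dgf_apply,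
    Set.ncard_eq_toFinset_card _ (finite_mem_size_eq _ _), ← Nat.cast_mul,
    ← Finset.card_product, ← Nat.cast_sum, ← Finset.card_sigma, Nat.cast_inj]
  refine Finset.card_bij (fun x _ => comp x.2.1 x.2.2) ?_ ?_ ?_ <;>
    simp only [Finset.mem_sigma, Nat.mem_divisorsAntidiagonal, Finset.mem_product,
      Set.Finite.mem_toFinset, Set.mem_ofPred_eq, Sigma.forall, Prod.forall]
  · rintro _ _ α β ⟨⟨rfl, -⟩, ⟨hα, rfl⟩, hβ, rfl⟩
    exact ⟨h.mapsTo (Set.mk_mem_prod hα hβ), size_comp α β⟩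
  · rintro _ _ α β ⟨-, ⟨hα, rfl⟩, hβ, rfl⟩ _ _ α' β' ⟨-, ⟨hα', rfl⟩, hβ', rfl⟩ hcomp
    obtain ⟨rfl, rfl⟩ :=
      Prod.ext_iff.1 (h.injOn (Set.mk_mem_prod hα hβ) (Set.mk_mem_prod hα' hβ') hcomp)
    rfl
  · rintro γ ⟨hγ, rfl⟩
    obtain ⟨⟨α, β⟩, ⟨hα, hβ⟩, rfl⟩ := h.surjOn hγ
    exact ⟨⟨⟨α.size, β.size⟩, α, β⟩, ⟨⟨(size_comp α β).symm, hn.ne'⟩, ⟨hα, rfl⟩, hβ, rfl⟩, rfl⟩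

theorem isUnit_zeta : IsUnit (zeta : ArithmeticFunction ℤ) :=
  IsUnit.of_mul_eq_one _ ArithmeticFunction.coe_zeta_mul_moebius

namespace IsMultiplicative

variable (hX : IsMultiplicative X)
include hX

theorem zeta_mul_dgf_not_hasUniformLeft (b : Bool) :
    (zeta : ArithmeticFunction ℤ) * dgf {α | α ∈ X ∧ ¬ α.HasUniformLeft b} = dgf X := by
  rw [← dgf_isUniform b]
  refine dgf_mul_of_bijOn ⟨?_, ?_, ?_⟩
  · rintro ⟨κ, β⟩ ⟨hκ, hβ, -⟩
    exact (hX.comp_mem_iff hκ.onlyTrivialFactorisations).2 ⟨hX.mem_of_isUniform hκ, hβ⟩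
  · rintro ⟨κ, β⟩ ⟨hκ, -, hβ⟩ ⟨κ', β'⟩ ⟨hκ', -, hβ'⟩ h
    exact Prod.ext_iff.2 (hκ.comp_inj hκ' hβ hβ' h)
  · intro α hα
    obtain ⟨κ, β, hκ, hβ, rfl⟩ := exists_uniform_comp b α
    exact ⟨(κ, β), ⟨hκ, ((hX.comp_mem_iff hκ.onlyTrivialFactorisations).1 hα).2, hβ⟩, rfl⟩

theorem dgf_irreducible_mul_dgf :
    dgf {π | π.IsIrreducible ∧ π ∈ X} * dgf X =
      dgf {α | α ∈ X ∧ ∃ π β, π.IsIrreducible ∧ α = comp π β} := by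
  refine dgf_mul_of_bijOn ⟨?_, ?_, ?_⟩
  · rintro ⟨π, β⟩ ⟨⟨hπ, hπX⟩, hβ⟩
    exact ⟨(hX.comp_mem_iff hπ.2.2).2 ⟨hπX, hβ⟩, π, β, hπ, rfl⟩
  · rintro ⟨π, β⟩ ⟨⟨hπ, -⟩, -⟩ ⟨π', β'⟩ ⟨⟨hπ', -⟩, -⟩ h
    exact Prod.ext_iff.2 (hπ.comp_inj hπ'.2.2 hπ'.ne_one h)
  · rintro α ⟨hα, π, β, hπ, rfl⟩
    obtain ⟨hπX, hβ⟩ := (hX.comp_mem_iff hπ.2.2).1 hα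
    exact ⟨(π, β), ⟨⟨hπ, hπX⟩, hβ⟩, rfl⟩

theorem dgf_forall_not_hasUniformLeft :
    dgf {α | α ∈ X ∧ ∀ b, ¬ α.HasUniformLeft b} =
      1 + dgf {π | π.IsIrreducible ∧ π ∈ X} * dgf X := by
  rw [hX.dgf_irreducible_mul_dgf, ← dgf_singleton_one, ← dgf_union_of_disjoint]
  · congr 1
    ext α
    have hone : α = one → α ∈ X := by
      rintro rfl
      exact hX.mem_of_isUniform (isUniform_one true)
    simp only [forall_not_hasUniformLeft_iff, Set.mem_union, Set.mem_singleton_iff,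
      Set.mem_ofPred_eq]
    tauto
  · rw [Set.disjoint_singleton_left]
    rintro ⟨-, π, β, hπ, h⟩
    exact hπ.ne_one (comp_eq_one_iff.1 h.symm).1

theorem dgf_not_hasUniformLeft_add :
    dgf {α | α ∈ X ∧ ¬ α.HasUniformLeft false} + dgf {α | α ∈ X ∧ ¬ α.HasUniformLeft true} =
      dgf X + (1 + dgf {π | π.IsIrreducible ∧ π ∈ X} * dgf X) := by
  rw [← hX.dgf_forall_not_hasUniformLeft, ← dgf_union_add_dgf_inter]
  congr 2 <;> ext α
  · have hnot : α.HasUniformLeft false → ¬ α.HasUniformLeft true :=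
      fun h h' => Bool.false_ne_true (h.bool_eq h')
    simp only [Set.mem_union, Set.mem_ofPred_eq]
    tauto
  · simp only [Set.mem_inter_iff, Set.mem_ofPred_eq, Bool.forall_bool, ← and_and_left]

theorem dgf_mul_eq_one :
    dgf X * (2 * Ring.inverse (zeta : ArithmeticFunction ℤ) - 1 -
      dgf {π | π.IsIrreducible ∧ π ∈ X}) = 1 := by
  have hadd := hX.dgf_not_hasUniformLeft_add
  have hfalse := hX.zeta_mul_dgf_not_hasUniformLeft false
  have htrue := hX.zeta_mul_dgf_not_hasUniformLeft true
  have hinv := Ring.inverse_mul_cancel _ isUnit_zeta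
  generalize dgf {α | α ∈ X ∧ ¬ α.HasUniformLeft false} = N₀ at *
  generalize dgf {α | α ∈ X ∧ ¬ α.HasUniformLeft true} = N₁ at *
  linear_combination hadd + (N₀ + N₁) * hinv -
    Ring.inverse (zeta : ArithmeticFunction ℤ) * (hfalse + htrue)

theorem isUnit_dgf : IsUnit (dgf X) :=
  IsUnit.of_mul_eq_one _ hX.dgf_mul_eq_one

theorem dgf_irreducible : dgf {π | π.IsIrreducible ∧ π ∈ X} =
    2 * Ring.inverse (zeta : ArithmeticFunction ℤ) - 1 - Ring.inverse (dgf X) := by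
  have hinv := (Ring.inverse_mul_eq_iff_eq_mul _ 1 _ hX.isUnit_dgf).2 hX.dgf_mul_eq_one.symm
  linear_combination hinv

end IsMultiplicative

theorem dgf_irreducible_normalised :
    dgf {α | α.IsIrreducible ∧ α.IsNormalised} =
      dgf {α | α.IsIrreducible ∧ α.IsNormalised ∧ ¬ α.IsSymmetric} +
        dgf {α | α.IsIrreducible ∧ α.IsSymmetric} := by
  rw [← dgf_union_of_disjoint]
  · congr 1
    ext α
    have hnorm : α.IsIrreducible → α.IsSymmetric → α.IsNormalised := fun hα hsymm =>
      hα.isNormalised_iff.2 hsymm.isLexMinimal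
    simp only [Set.mem_union, Set.mem_ofPred_eq]
    tauto
  · exact Set.disjoint_left.2 fun α hα hα' => hα.2.2 hα'.2

end DirichletSeries

section CountingSymmetric

theorem exists_modEq_or_neg_modEq {n : ℕ} (hn : 0 < n) {i : ℤ} (hi : ¬ (n : ℤ) ∣ i) :
    ∃ k ∈ Set.Icc 1 (n / 2), i ≡ k [ZMOD n] ∨ -i ≡ k [ZMOD n] := by
  have hpos : 0 < i % n := (Int.emod_nonneg i (by lia)).lt_of_ne' (mt Int.dvd_of_emod_eq_zero hi)
  have hlt : i % n < n := Int.emod_lt_of_pos i (by lia)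
  rcases le_or_gt (i % n) (n / 2 : ℕ) with hle | hgt
  · refine ⟨(i % n).toNat, ⟨by lia, by lia⟩, Or.inl ?_⟩
    rw [Int.toNat_of_nonneg hpos.le]
    exact (Int.mod_modEq i n).symm
  · refine ⟨(n - i % n).toNat, ⟨by lia, by lia⟩, Or.inr ?_⟩
    rw [Int.toNat_of_nonneg (by lia), Int.modEq_iff_dvd]
    exact ⟨1 + i / n, by linarith [Int.mul_ediv_add_emod i n]⟩

theorem eq_of_modEq_or_neg_modEq {n k l : ℕ} (hk : k ∈ Set.Icc 1 (n / 2))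
    (hl : l ∈ Set.Icc 1 (n / 2)) (h : (k : ℤ) ≡ l [ZMOD n] ∨ -(k : ℤ) ≡ l [ZMOD n]) : k = l := by
  rw [Set.mem_Icc] at hk hl
  rcases h with h | h
  · exact (Int.natCast_modEq_iff.1 h).eq_of_lt_of_lt (by lia) (by lia)
  · rw [Int.modEq_iff_dvd, sub_neg_eq_add] at h
    have hle : n ≤ l + k := Nat.le_of_dvd (by lia) (mod_cast h)
    lia

/-- The cuts of `α` in the lower half of its range; they determine `α` if it is symmetric. -/
def lowerCuts (α : Compn) : Set ℕ :=
  {k | k ∈ Set.Icc 1 (α.size / 2) ∧ α.IsCut k}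

theorem IsSymmetric.isCut_neg {α : Compn} (h : α.IsSymmetric) (i : ℤ) :
    α.IsCut (-i) ↔ α.IsCut i := by
  rw [← isCut_reversal, ← h]

theorem IsSymmetric.eq_of_lowerCuts_eq {α β : Compn} (hα : α.IsSymmetric) (hβ : β.IsSymmetric)
    (hsize : α.size = β.size) (h : α.lowerCuts = β.lowerCuts) : α = β := by
  have hcut : ∀ k ∈ Set.Icc 1 (α.size / 2), (α.IsCut k ↔ β.IsCut k) := fun k hk =>
    (and_iff_right hk).symm.trans ((Set.ext_iff.1 h k).trans (and_iff_right (hsize ▸ hk)))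
  refine ext_isCut hsize fun i hi => ?_
  obtain ⟨k, hk, hik | hik⟩ := exists_modEq_or_neg_modEq α.one_le_size hi
  · exact (isCut_congr hik).trans ((hcut k hk).trans (isCut_congr (hsize ▸ hik)).symm)
  · rw [← hα.isCut_neg, ← hβ.isCut_neg]
    exact (isCut_congr hik).trans ((hcut k hk).trans (isCut_congr (hsize ▸ hik)).symm)

theorem exists_isSymmetric_lowerCuts_eq {n : ℕ} (hn : 0 < n) {s : Set ℕ}
    (hs : s ⊆ Set.Icc 1 (n / 2)) :
    ∃ α : Compn, (α.IsSymmetric ∧ α.size = n) ∧ α.lowerCuts = s := by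
  let p : ℤ → Prop := fun i => ∃ k ∈ s, i ≡ k [ZMOD n] ∨ -i ≡ k [ZMOD n]
  have hp : IsPeriodicOff n p := fun i j _ hij => exists_congr fun k => and_congr_right fun _ =>
    or_congr ⟨hij.symm.trans, hij.trans⟩ ⟨hij.neg.symm.trans, hij.neg.trans⟩
  obtain ⟨α, rfl, hα⟩ := exists_isCut_iff hn hp
  refine ⟨α, ⟨isSymmetric_iff_isCut_neg.2 fun i hi => ?_, rfl⟩, Set.ext fun k => ?_⟩
  · rw [hα i hi, hα (-i) (by rwa [dvd_neg])]
    simp only [p, neg_neg, or_comm]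
  · have hdvd : k ∈ Set.Icc 1 (α.size / 2) → ¬ (α.size : ℤ) ∣ k := fun hk hdvd => by
      have := Nat.le_of_dvd hk.1 (mod_cast hdvd)
      have := hk.2
      lia
    constructor
    · rintro ⟨hk, hcut⟩
      obtain ⟨l, hl, hkl⟩ := (hα k (hdvd hk)).1 hcut
      rwa [eq_of_modEq_or_neg_modEq hk (hs hl) hkl]
    · intro hk
      exact ⟨hs hk, (hα k (hdvd (hs hk))).2 ⟨k, hk, Or.inl rfl⟩⟩

theorem bijOn_lowerCuts {n : ℕ} (hn : 0 < n) :
    Set.BijOn lowerCuts {α | α.IsSymmetric ∧ α.size = n} (𝒫 Set.Icc 1 (n / 2)) := by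
  refine ⟨?_, ?_, fun s hs => exists_isSymmetric_lowerCuts_eq hn hs⟩
  · rintro α ⟨-, rfl⟩ k hk
    exact hk.1
  · rintro α ⟨hα, hαn⟩ β ⟨hβ, hβn⟩ h
    exact hα.eq_of_lowerCuts_eq hβ (hαn.trans hβn.symm) h

theorem ncard_isSymmetric_size_eq {n : ℕ} (hn : 0 < n) :
    {α : Compn | α.IsSymmetric ∧ α.size = n}.ncard = 2 ^ (n / 2) := by
  rw [(bijOn_lowerCuts hn).ncard_eq, Set.ncard_powerset _ (Set.finite_Icc _ _),
    Set.ncard_eq_toFinset_card', Set.toFinset_Icc, Nat.card_Icc, Nat.add_sub_cancel]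

theorem dgf_isSymmetric_apply {n : ℕ} (hn : 0 < n) : dgf {α | α.IsSymmetric} n = 2 ^ (n / 2) := by
  simp only [dgf_apply, Set.mem_ofPred_eq, ncard_isSymmetric_size_eq hn, Nat.cast_pow,
    Nat.cast_ofNat]

end CountingSymmetric

end Compn

theorem mainTheorem2
    (P Psym Pasym R S ζ : ArithmeticFunction ℤ)
    (hP : P = Compn.dgf {α | α.IsIrreducible ∧ α.IsNormalised})
    (hPsym : Psym = Compn.dgf {α | α.IsIrreducible ∧ α.IsSymmetric})
    (hPasym : Pasym = Compn.dgf {α | α.IsIrreducible ∧ α.IsNormalised ∧ ¬ α.IsSymmetric})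
    (hR : R = Compn.dgf {α | α.IsNormalised})
    (hS : S = Compn.dgf {α | α.IsSymmetric})
    (hζ : ζ = (ArithmeticFunction.zeta : ArithmeticFunction ℤ)) :
    (∀ n : ℕ, 1 ≤ n → S n = 2 ^ (n / 2)) ∧
    (IsUnit ζ ∧ IsUnit R ∧ IsUnit S) ∧
    P = 2 * Ring.inverse ζ - 1 - Ring.inverse R ∧
    Psym = 2 * Ring.inverse ζ - 1 - Ring.inverse S ∧
    Pasym = Ring.inverse S - Ring.inverse R := by
  subst hP hPsym hPasym hR hS hζ
  have hR := Compn.isMultiplicative_isNormalised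
  have hS := Compn.isMultiplicative_isSymmetric
  have hP : Compn.dgf {α | α.IsIrreducible ∧ α.IsNormalised} = _ := hR.dgf_irreducible
  have hPsym : Compn.dgf {α | α.IsIrreducible ∧ α.IsSymmetric} = _ := hS.dgf_irreducible
  refine ⟨fun n => Compn.dgf_isSymmetric_apply,
    ⟨Compn.isUnit_zeta, hR.isUnit_dgf, hS.isUnit_dgf⟩, hP, hPsym, ?_⟩
  linear_combination hP - hPsym - Compn.dgf_irreducible_normalised
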